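/- Let $K$ be a field, $n \ge 0$, and $R = K[x_1,\ldots,x_n]$. Let $I$ be a monomial ideal of $R$ with $\deg(I) \le 2$, where $\deg(I)$ denotes the maximum of the total degrees of the minimal monomial generators of $I$ (with $\deg(0)=0$). If $I \neq 0$, then $I$ has the strong persistence property: $$(I^{k+1} : I) = I^k \quad \text{for all } k \ge 1,$$ where $(J:I)=\{f\in R \mid fI\subseteq J\}$. Moreover $I$ (whether zero or not) has the persistence property: $$\operatorname{Ass}(R/I^k) \subseteq \operatorname{Ass}(R/I^{k+1}) \quad \text{for all } k \ge 1,$$ where $\operatorname{Ass}(M)$ denotes the set of associated primes of the $R$-module $M$. -/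

import Mathlib

/-- An ideal of `K[x₁, …, xₙ]` is a monomial ideal if it is generated by a set of monomials. -/
def IsMonomialIdeal {n : ℕ} {K : Type*} [Field K] (I : Ideal (MvPolynomial (Fin n) K)) : Prop :=
  ∃ S : Set (Fin n →₀ ℕ), I = Ideal.span ((fun a => MvPolynomial.monomial a (1 : K)) '' S)

/-- The exponent vectors of the minimal monomial generators of a monomial ideal `I`: those `a`
such that `x ^ a` is minimal, with respect to divisibility, among the monomials lying in `I`. -/
def minimalGenerators {n : ℕ} {K : Type*} [Field K] (I : Ideal (MvPolynomial (Fin n) K)) :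
    Set (Fin n →₀ ℕ) :=
  {a | Minimal (fun b => MvPolynomial.monomial b (1 : K) ∈ I) a}

/-- There are finitely many minimal monomial generators (Dickson's lemma). -/
theorem minimalGenerators_finite {n : ℕ} {K : Type*} [Field K]
    (I : Ideal (MvPolynomial (Fin n) K)) : (minimalGenerators I).Finite := by
  apply WellQuasiOrderedLE.finite_of_isAntichain
  exact setOfPred_minimal_antichain _

/-- The degree of a monomial ideal: the largest total degree of its minimal monomial generators
(with value `0` for the zero ideal, which has none). -/
noncomputable def monomialIdealDegree {n : ℕ} {K : Type*} [Field K]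
    (I : Ideal (MvPolynomial (Fin n) K)) : ℕ :=
  (minimalGenerators_finite I).toFinset.sup Finsupp.degree

/-- The strong persistence property: `(I ^ (k + 1) : I) = I ^ k` for all `k ≥ 1`. -/
def StrongPersistence {R : Type*} [CommRing R] (I : Ideal R) : Prop :=
  ∀ k : ℕ, 1 ≤ k → (I ^ (k + 1)).colon (I : Set R) = I ^ k

/-- The persistence property: `Ass(R / I ^ k) ⊆ Ass(R / I ^ (k + 1))` for all `k ≥ 1`. -/
def Persistence {R : Type*} [CommRing R] (I : Ideal R) : Prop :=
  ∀ k : ℕ, 1 ≤ k → associatedPrimes R (R ⧸ I ^ k) ⊆ associatedPrimes R (R ⧸ I ^ (k + 1))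

/-! Read generators of degree 2 as edges (loops allowed) and `a` as vertex capacities: `x ^ a` lies
in `I ^ k` iff `k` edges, with repetition, pack into `a`. Strong persistence then says: if `a + e`
packs `k + 1` edges for every edge `e`, then `a` packs `k`.

Otherwise the maximum `ν` for `a` is below `k`. Each edge `xz` then gives edges `xu`, `zv` with `u`,
`v` missed together by a maximum packing (`exists_missesPair_of_add`). As in Gallai's lemma,
alternating paths (`IsPacking.exchange`) make "never missed together" transitive on missed vertices;
adjacent vertices are never missed together, and a few edges then contradict each other.

Persistence follows from strong persistence by writing a colon ideal as a finite intersection. -/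

/-- `M` is a multiset of elements of `E` whose sum, together with the leftover `L`, is `a`. -/
structure IsPacking {V : Type*} (E : Set (V →₀ ℕ)) (a : V →₀ ℕ) (M : Multiset (V →₀ ℕ))
    (L : V →₀ ℕ) : Prop where
  mem : ∀ e ∈ M, e ∈ E
  sum_add : M.sum + L = a

/-! ### Splitting exponent vectors and multisets -/

theorem exists_eq_add_single {V : Type*} {f : V →₀ ℕ} {w : V} (h : 0 < f w) :
    ∃ g, f = g + Finsupp.single w 1 := by
  classical
  refine ⟨f - Finsupp.single w 1, (tsub_add_cancel_of_le ?_).symm⟩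
  intro v
  rw [Finsupp.single_apply]
  split_ifs with hv
  · subst hv; exact h
  · exact Nat.zero_le _

theorem exists_eq_single_add_single {V : Type*} {e : V →₀ ℕ} (he : e.degree = 2) {w : V}
    (hw : 0 < e w) : ∃ u, e = Finsupp.single w 1 + Finsupp.single u 1 := by
  obtain ⟨g, rfl⟩ := exists_eq_add_single hw
  have hg : g.degree = 1 := by
    rw [map_add, Finsupp.degree_single] at he
    omega
  have hg0 : g ≠ 0 := by rintro rfl; simp at hg
  obtain ⟨u, hu⟩ := Finsupp.ne_iff.mp hg0
  obtain ⟨h, rfl⟩ := exists_eq_add_single (Nat.pos_of_ne_zero hu)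
  have hh : h.degree = 0 := by
    rw [map_add, Finsupp.degree_single] at hg
    omega
  rw [Finsupp.degree_eq_zero_iff] at hh
  exact ⟨u, by rw [hh, zero_add, add_comm]⟩

theorem exists_mem_of_sum_apply_pos {V : Type*} {M : Multiset (V →₀ ℕ)} {w : V}
    (h : 0 < M.sum w) : ∃ e ∈ M, 0 < e w := by
  induction M using Multiset.induction_on with
  | empty => simp at h
  | cons e M ih =>
    rw [Multiset.sum_cons, Finsupp.add_apply] at h
    by_cases he : 0 < e w
    · exact ⟨e, Multiset.mem_cons_self _ _, he⟩
    · obtain ⟨f, hf, hfw⟩ := ih (by omega)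
      exact ⟨f, Multiset.mem_cons_of_mem hf, hfw⟩

theorem exists_count_lt_of_sum_apply_lt {V : Type*} [DecidableEq V] {M N : Multiset (V →₀ ℕ)}
    {w : V} (h : M.sum w < N.sum w) : ∃ e, M.count e < N.count e ∧ 0 < e w := by
  have h1 : N ≤ M + (N - M) := le_add_tsub
  obtain ⟨P, hP⟩ := Multiset.le_iff_exists_add.mp h1
  have h2 : M.sum w + (N - M).sum w = N.sum w + P.sum w := by
    have := congrArg (fun Q : Multiset (V →₀ ℕ) => Q.sum w) hP
    simpa using this
  obtain ⟨e, he, hew⟩ := exists_mem_of_sum_apply_pos (M := N - M) (w := w) (by omega)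
  refine ⟨e, ?_, hew⟩
  have := Multiset.count_pos.mpr he
  rw [Multiset.count_sub] at this
  omega

/-! ### Packings and alternating exchange -/

section Packing

variable {V : Type*} {E : Set (V →₀ ℕ)} {a : V →₀ ℕ}

theorem IsPacking.erase [DecidableEq V] {M : Multiset (V →₀ ℕ)} {L e : V →₀ ℕ}
    (h : IsPacking E a M L) (he : e ∈ M) : IsPacking E a (M.erase e) (e + L) where
  mem f hf := h.mem f (Multiset.mem_of_mem_erase hf)
  sum_add := by
    rw [← h.sum_add, ← add_assoc, add_comm _ e, ← Multiset.sum_cons, Multiset.cons_erase he]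

theorem IsPacking.cons {M : Multiset (V →₀ ℕ)} {L e : V →₀ ℕ}
    (h : IsPacking E a M (e + L)) (he : e ∈ E) : IsPacking E a (e ::ₘ M) L where
  mem f hf := by
    rcases Multiset.mem_cons.mp hf with rfl | hf
    exacts [he, h.mem f hf]
  sum_add := by
    rw [← h.sum_add, Multiset.sum_cons]
    abel

theorem IsPacking.of_add {M : Multiset (V →₀ ℕ)} {L b : V →₀ ℕ}
    (h : IsPacking E (a + b) M (L + b)) : IsPacking E a M L where
  mem := h.mem
  sum_add := add_right_cancel (b := b) (by rw [add_assoc]; exact h.sum_add)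

theorem IsPacking.exists_card_pred {k : ℕ} {M : Multiset (V →₀ ℕ)}
    {L : V →₀ ℕ} (h : IsPacking E a M L) (hM : M.card = k + 1) :
    ∃ N L', IsPacking E a N L' ∧ N.card = k := by
  classical
  obtain ⟨e, he⟩ := Multiset.card_pos_iff_exists_mem.mp (show 0 < M.card by omega)
  exact ⟨_, _, h.erase he, by rw [Multiset.card_erase_of_mem he, hM]; rfl⟩

theorem IsPacking.exists_card_le {k : ℕ} {M : Multiset (V →₀ ℕ)}
    {L : V →₀ ℕ} (h : IsPacking E a M L) (hM : k ≤ M.card) :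
    ∃ N L', IsPacking E a N L' ∧ N.card = k := by
  induction hn : M.card - k generalizing M L with
  | zero => exact ⟨M, L, h, by omega⟩
  | succ d ih =>
    obtain ⟨N, L', hN, hc⟩ := h.exists_card_pred (k := k + d) (by omega)
    exact ih hN (by omega) (by omega)

/-- One extra unit of capacity is used by at most one edge, so dropping that edge suffices. -/
theorem IsPacking.exists_of_add_single {k : ℕ} {M : Multiset (V →₀ ℕ)}
    {L : V →₀ ℕ} {w : V} (h : IsPacking E (a + Finsupp.single w 1) M L) (hM : M.card = k + 1) :
    ∃ N L', IsPacking E a N L' ∧ N.card = k := by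
  classical
  by_cases hL : 0 < L w
  · obtain ⟨L', rfl⟩ := exists_eq_add_single hL
    exact h.of_add.exists_card_pred hM
  · have hw : 0 < M.sum w := by
      have := DFunLike.congr_fun h.sum_add w
      simp only [Finsupp.add_apply, Finsupp.single_eq_same] at this
      omega
    obtain ⟨e, he, hew⟩ := exists_mem_of_sum_apply_pos hw
    obtain ⟨g, rfl⟩ := exists_eq_add_single hew
    refine ⟨_, g + L, IsPacking.of_add (b := Finsupp.single w 1) ?_,
      by rw [Multiset.card_erase_of_mem he, hM]; rfl⟩
    rw [add_right_comm]
    exact h.erase he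

/-- Exchange property of maximum packings: if a vertex `w` is missed by a maximum packing `M`, then
any packing `N` of the same size can be changed so that it misses `w`, at the cost of covering just
one further vertex `t`. -/
theorem IsPacking.exchange [DecidableEq V] {ν : ℕ} (hE : ∀ e ∈ E, e.degree = 2)
    (hmax : ∀ M L, IsPacking E a M L → M.card ≤ ν) (d : ℕ) :
    ∀ (M N : Multiset (V →₀ ℕ)) (LM LN : V →₀ ℕ) (w : V),
      IsPacking E a M (LM + Finsupp.single w 1) → M.card = ν →
      IsPacking E a N LN → N.card = ν → (N - M).card = d →
      ∃ N' L t, IsPacking E a N' (L + Finsupp.single w 1) ∧ N'.card = ν ∧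
        LN = L + Finsupp.single t 1 ∧ M ∩ N ≤ N' := by
  induction d with
  | zero =>
    intro M N LM LN w hM hMc hN hNc hd
    have hle : N ≤ M := by
      rw [Multiset.card_eq_zero] at hd
      exact tsub_eq_zero_iff_le.mp hd
    obtain rfl := Multiset.eq_of_le_of_card_le hle (by omega)
    have hL : LN = LM + Finsupp.single w 1 :=
      add_left_cancel (hN.sum_add.trans hM.sum_add.symm)
    exact ⟨N, LM, w, hM, hMc, hL, Multiset.inter_le_left⟩
  | succ d ih =>
    intro M N LM LN w hM hMc hN hNc hd
    by_cases hw : 0 < LN w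
    · obtain ⟨L, rfl⟩ := exists_eq_add_single hw
      exact ⟨N, L, w, hN, hNc, rfl, Multiset.inter_le_right⟩
    have h1 : M.sum w < N.sum w := by
      have e1 := DFunLike.congr_fun hM.sum_add w
      have e2 := DFunLike.congr_fun hN.sum_add w
      simp only [Finsupp.add_apply, Finsupp.single_eq_same] at e1 e2
      omega
    obtain ⟨e, hce, hew⟩ := exists_count_lt_of_sum_apply_lt h1
    have heN : e ∈ N := Multiset.count_pos.mp (by omega)
    obtain ⟨w₁, he⟩ := exists_eq_single_add_single (hE e (hN.mem e heN)) hew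
    -- Otherwise both ends of `e` are free in `M` (twice the same vertex for a loop), and adding `e`
    -- beats the maximum.
    have hLM : LM w₁ = 0 := by
      by_contra hne
      obtain ⟨L, rfl⟩ := exists_eq_add_single (Nat.pos_of_ne_zero hne)
      have hM' : IsPacking E a M (e + L) := by
        rw [he]
        convert hM using 1
        abel
      have := hmax _ _ (hM'.cons (hN.mem e heN))
      rw [Multiset.card_cons] at this
      omega
    have h2 : N.sum w₁ < (e ::ₘ M).sum w₁ := by
      have e1 := DFunLike.congr_fun hM.sum_add w₁
      have e2 := DFunLike.congr_fun hN.sum_add w₁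
      rw [Multiset.sum_cons, he]
      simp only [Finsupp.add_apply, Finsupp.single_eq_same] at e1 e2 ⊢
      omega
    obtain ⟨f, hcf, hfw⟩ := exists_count_lt_of_sum_apply_lt h2
    have hfe : f ≠ e := by
      rintro rfl
      rw [Multiset.count_cons_self] at hcf
      omega
    rw [Multiset.count_cons_of_ne hfe] at hcf
    have hfM : f ∈ M := Multiset.count_pos.mp (by omega)
    obtain ⟨w₂, hf⟩ := exists_eq_single_add_single (hE f (hM.mem f hfM)) hfw
    -- Two steps along an alternating path: trading `f` for `e` moves the missed vertex from `w` to
    -- `w₂` and brings `M` closer to `N`.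
    have hM₁ : IsPacking E a (e ::ₘ M.erase f) (LM + Finsupp.single w₂ 1) := by
      refine IsPacking.cons ?_ (hN.mem e heN)
      convert hM.erase hfM using 1
      rw [he, hf]
      abel
    have hM₁c : (e ::ₘ M.erase f).card = ν := by
      have := Multiset.card_pos_iff_exists_mem.mpr ⟨f, hfM⟩
      rw [Multiset.card_cons, Multiset.card_erase_of_mem hfM, Nat.pred_eq_sub_one]
      omega
    have hd₁ : (N - (e ::ₘ M.erase f)).card = d := by
      have : N - M = e ::ₘ (N - (e ::ₘ M.erase f)) := by
        ext g
        by_cases hge : g = e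
        · subst hge
          simp only [Multiset.count_sub, Multiset.count_cons_self,
            Multiset.count_erase_of_ne hfe.symm]
          omega
        · by_cases hgf : g = f
          · subst hgf
            simp only [Multiset.count_sub, Multiset.count_cons_of_ne hfe,
              Multiset.count_erase_self]
            omega
          · simp only [Multiset.count_sub, Multiset.count_cons_of_ne hge,
              Multiset.count_erase_of_ne hgf]
      rw [this, Multiset.card_cons] at hd
      omega
    obtain ⟨N', L, t, hN', hN'c, hLN, hle⟩ := ih _ _ _ _ w₂ hM₁ hM₁c hN hNc hd₁
    -- The clause `M ∩ N ≤ N'` in the induction exists for this: `e` survives in `N'`, so it can be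
    -- traded back for `f`, freeing `w`.
    have heN' : e ∈ N' := Multiset.mem_of_le hle
      (Multiset.mem_inter.mpr ⟨Multiset.mem_cons_self _ _, heN⟩)
    refine ⟨f ::ₘ N'.erase e, L, t, ?_, ?_, hLN, ?_⟩
    · refine IsPacking.cons ?_ (hM.mem f hfM)
      convert hN'.erase heN' using 1
      rw [he, hf]
      abel
    · have := Multiset.card_pos_iff_exists_mem.mpr ⟨e, heN'⟩
      rw [Multiset.card_cons, Multiset.card_erase_of_mem heN', Nat.pred_eq_sub_one]
      omega
    · rw [Multiset.le_iff_count] at hle ⊢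
      intro g
      have hg := hle g
      by_cases hge : g = e
      · subst hge
        simp only [Multiset.count_inter, Multiset.count_cons_self, Multiset.count_erase_self,
          Multiset.count_erase_of_ne hfe.symm, Multiset.count_cons_of_ne hfe.symm] at hg ⊢
        omega
      · by_cases hgf : g = f
        · subst hgf
          simp only [Multiset.count_inter, Multiset.count_cons_self, Multiset.count_erase_self,
            Multiset.count_erase_of_ne hge, Multiset.count_cons_of_ne hge] at hg ⊢
          omega
        · simpa only [Multiset.count_inter, Multiset.count_cons_of_ne hge,
            Multiset.count_erase_of_ne hgf, Multiset.count_cons_of_ne hgf,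
            Multiset.count_erase_of_ne hge] using hg

/-! ### Pairs missed by maximum packings -/

/-- Some packing of size `ν` misses both `u` and `v`. -/
def MissesPair (E : Set (V →₀ ℕ)) (a : V →₀ ℕ) (ν : ℕ) (u v : V) : Prop :=
  ∃ M L, IsPacking E a M (L + Finsupp.single u 1 + Finsupp.single v 1) ∧ M.card = ν

theorem MissesPair.symm {ν : ℕ} {u v : V} (h : MissesPair E a ν u v) : MissesPair E a ν v u := by
  obtain ⟨M, L, hM, hc⟩ := h
  exact ⟨M, L, by rwa [add_right_comm], hc⟩

theorem MissesPair.notMem {ν : ℕ} (hmax : ∀ M L, IsPacking E a M L → M.card ≤ ν) {u v : V}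
    (h : MissesPair E a ν u v) : Finsupp.single u 1 + Finsupp.single v 1 ∉ E := by
  intro huv
  obtain ⟨M, L, hM, hc⟩ := h
  rw [add_assoc, add_comm L] at hM
  have := hmax _ _ (hM.cons huv)
  rw [Multiset.card_cons] at this
  omega

/-- Not being missed simultaneously by a maximum packing is a transitive relation on the vertices
that are missed by some maximum packing. -/
theorem MissesPair.or_of_misses {ν : ℕ} (hE : ∀ e ∈ E, e.degree = 2)
    (hmax : ∀ M L, IsPacking E a M L → M.card ≤ ν) {u v w x : V}
    (h : MissesPair E a ν u v) (hw : MissesPair E a ν w x) :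
    MissesPair E a ν u w ∨ MissesPair E a ν v w := by
  classical
  obtain ⟨N, L, hN, hNc⟩ := h
  obtain ⟨M, LM, hM, hMc⟩ := hw.symm
  obtain ⟨N', L', t, hN', hN'c, hL, -⟩ :=
    IsPacking.exchange hE hmax _ M N _ _ w hM hMc hN hNc rfl
  -- The exchange covers only one new vertex `t`, so `u` or `v` stays missed.
  by_cases ht : t = v
  · subst ht
    obtain rfl := add_right_cancel hL
    exact .inl ⟨N', L, hN', hN'c⟩
  · right
    have : 0 < L' v := by
      have := DFunLike.congr_fun hL v
      simp only [Finsupp.add_apply, Finsupp.single_eq_same, Finsupp.single_eq_of_ne' ht] at this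
      omega
    obtain ⟨L'', rfl⟩ := exists_eq_add_single this
    exact ⟨N', L'', hN', hN'c⟩

/-- Both added units must be used, by two different edges of `N`: otherwise deleting one edge would
leave `ν + 1` edges inside `a`. Deleting the two edges frees their other ends `u` and `v`. -/
theorem exists_missesPair_of_add {ν : ℕ} (hE : ∀ e ∈ E, e.degree = 2)
    (hmax : ∀ M L, IsPacking E a M L → M.card ≤ ν) {x z : V} {N : Multiset (V →₀ ℕ)}
    {L : V →₀ ℕ} (hN : IsPacking E (a + (Finsupp.single x 1 + Finsupp.single z 1)) N L)
    (hc : N.card = ν + 2) :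
    ∃ u v, Finsupp.single x 1 + Finsupp.single u 1 ∈ E ∧
      Finsupp.single z 1 + Finsupp.single v 1 ∈ E ∧ MissesPair E a ν u v := by
  classical
  rw [← add_assoc, add_right_comm] at hN
  have hLx : L x = 0 := by
    by_contra hne
    obtain ⟨L', rfl⟩ := exists_eq_add_single (Nat.pos_of_ne_zero hne)
    obtain ⟨N', L'', hN', hc'⟩ := hN.of_add.exists_of_add_single hc
    have := hmax _ _ hN'
    omega
  obtain ⟨f, hfN, hfx⟩ : ∃ e ∈ N, 0 < e x := by
    apply exists_mem_of_sum_apply_pos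
    have := DFunLike.congr_fun hN.sum_add x
    simp only [Finsupp.add_apply, Finsupp.single_eq_same] at this
    omega
  have hfE := hN.mem f hfN
  obtain ⟨u, rfl⟩ := exists_eq_single_add_single (hE f hfE) hfx
  have hN₁ : IsPacking E (a + Finsupp.single z 1)
      (N.erase (Finsupp.single x 1 + Finsupp.single u 1)) (Finsupp.single u 1 + L) := by
    apply IsPacking.of_add (b := Finsupp.single x 1)
    convert hN.erase hfN using 1
    abel
  have hc₁ := Multiset.card_erase_of_mem hfN
  rw [hc, Nat.pred_eq_sub_one] at hc₁
  generalize N.erase _ = N₁ at hN₁ hc₁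
  have hLz : (Finsupp.single u 1 + L : V →₀ ℕ) z = 0 := by
    by_contra hne
    obtain ⟨L', hL'⟩ := exists_eq_add_single (Nat.pos_of_ne_zero hne)
    rw [hL'] at hN₁
    have := hmax _ _ hN₁.of_add
    omega
  obtain ⟨g, hgN, hgz⟩ : ∃ e ∈ N₁, 0 < e z := by
    apply exists_mem_of_sum_apply_pos
    have := DFunLike.congr_fun hN₁.sum_add z
    rw [Finsupp.add_apply, hLz] at this
    simp only [Finsupp.add_apply, Finsupp.single_eq_same] at this
    omega
  have hgE := hN₁.mem g hgN
  obtain ⟨v, rfl⟩ := exists_eq_single_add_single (hE g hgE) hgz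
  refine ⟨u, v, hfE, hgE, N₁.erase _, L, ?_,
    by rw [Multiset.card_erase_of_mem hgN, hc₁]; rfl⟩
  apply IsPacking.of_add (b := Finsupp.single z 1)
  convert hN₁.erase hgN using 1
  abel

theorem exists_packing_of_forall_add_of_degree_eq_two (hE : ∀ e ∈ E, e.degree = 2)
    (hne : E.Nonempty) {k : ℕ}
    (h : ∀ e ∈ E, ∃ M L, IsPacking E (a + e) M L ∧ M.card = k + 1) :
    ∃ M L, IsPacking E a M L ∧ M.card = k := by
  by_contra hk
  have hbdd : ∀ M L, IsPacking E a M L → M.card ≤ k := by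
    intro M L hM
    by_contra! hlt
    exact hk (hM.exists_card_le hlt.le)
  obtain ⟨ν, ⟨M, L, hM, hMc⟩, hν⟩ :
      ∃ ν, (∃ M L, IsPacking E a M L ∧ M.card = ν) ∧
        ∀ ν', (∃ M L, IsPacking E a M L ∧ M.card = ν') → ν' ≤ ν := by
    have hfin : {ν | ∃ M L, IsPacking E a M L ∧ M.card = ν}.Finite := by
      apply (Set.finite_Iic k).subset
      rintro _ ⟨M, L, hM, rfl⟩
      exact hbdd M L hM
    obtain ⟨ν, hν, hmax⟩ := hfin.exists_maximalFor id _
      ⟨0, 0, a, ⟨by simp, by simp⟩, by simp⟩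
    refine ⟨ν, hν, fun ν' h' => ?_⟩
    by_contra! hlt
    exact absurd (hmax h' hlt.le) (not_le.mpr hlt)
  have hmax : ∀ M L, IsPacking E a M L → M.card ≤ ν := fun M L h => hν _ ⟨M, L, h, rfl⟩
  have hlt : ν < k := by
    refine lt_of_le_of_ne (hMc ▸ hbdd M L hM) ?_
    rintro rfl
    exact hk ⟨M, L, hM, hMc⟩
  have key : ∀ x z, Finsupp.single x 1 + Finsupp.single z 1 ∈ E →
      ∃ u v, Finsupp.single x 1 + Finsupp.single u 1 ∈ E ∧
        Finsupp.single z 1 + Finsupp.single v 1 ∈ E ∧ MissesPair E a ν u v := by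
    intro x z hxz
    obtain ⟨N, L, hN, hc⟩ := h _ hxz
    obtain ⟨N, L, hN, hc⟩ := hN.exists_card_le (k := ν + 2) (by omega)
    exact exists_missesPair_of_add hE hmax hN hc
  obtain ⟨e, he⟩ := hne
  obtain ⟨x, hx⟩ : ∃ x, 0 < e x := by
    by_contra! hx
    have h0 : e = 0 := by ext x; simpa using hx x
    have := hE e he
    simp [h0] at this
  obtain ⟨z, rfl⟩ := exists_eq_single_add_single (hE e he) hx
  obtain ⟨u, _, hxu, -, hu⟩ := key x z he
  obtain ⟨_, v, -, huv, hv⟩ := key x u hxu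
  obtain ⟨s, t, hus, hvt, hst⟩ := key u v huv
  -- Each of `us`, `uv`, `vt` is an edge, so transitivity along `s`, `u`, `v`, `t` would forbid
  -- missing `s` and `t` together.
  rcases hst.or_of_misses hE hmax hu with h1 | h1
  · exact h1.symm.notMem hmax hus
  · rcases h1.or_of_misses hE hmax hv.symm with h2 | h2
    · exact h2.symm.notMem hmax hvt
    · exact h2.notMem hmax huv

theorem exists_packing_of_forall_add (hE : ∀ e ∈ E, e.degree ≤ 2) (hne : E.Nonempty) {k : ℕ}
    (h : ∀ e ∈ E, ∃ M L, IsPacking E (a + e) M L ∧ M.card = k + 1) :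
    ∃ M L, IsPacking E a M L ∧ M.card = k := by
  by_cases h2 : ∀ e ∈ E, e.degree = 2
  · exact exists_packing_of_forall_add_of_degree_eq_two h2 hne h
  push Not at h2
  obtain ⟨e, he, hd⟩ := h2
  obtain ⟨M, L, hM, hc⟩ := h e he
  -- A generator of degree at most 1 settles the claim alone: adding it to `a` gains at most one
  -- edge.
  by_cases h0 : e = 0
  · rw [h0, add_zero] at hM
    exact hM.exists_card_pred hc
  obtain ⟨x, hx⟩ := Finsupp.ne_iff.mp h0
  obtain ⟨g, rfl⟩ := exists_eq_add_single (Nat.pos_of_ne_zero hx)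
  have hg : g = 0 := by
    have := hE _ he
    rw [map_add, Finsupp.degree_single] at this hd
    rw [← Finsupp.degree_eq_zero_iff]
    omega
  rw [hg, zero_add] at hM
  exact hM.exists_of_add_single hc

end Packing

/-! ### From packings to powers of monomial ideals -/

section Monomial

variable {σ K : Type*} [Field K]

theorem span_monomial_pow (E : Set (σ →₀ ℕ)) (k : ℕ) :
    Ideal.span ((fun a => MvPolynomial.monomial a (1 : K)) '' E) ^ k =
      Ideal.span ((fun a => MvPolynomial.monomial a (1 : K)) ''
        {b | ∃ M : Multiset (σ →₀ ℕ), (∀ e ∈ M, e ∈ E) ∧ M.card = k ∧ M.sum = b}) := by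
  induction k with
  | zero =>
    rw [pow_zero, eq_comm, Ideal.one_eq_top, Ideal.eq_top_iff_one]
    exact Ideal.subset_span ⟨0, ⟨0, by simp⟩, rfl⟩
  | succ k ih =>
    rw [pow_succ, ih, Ideal.span_mul_span']
    congr 1
    ext f
    simp only [Set.mem_mul, Set.mem_image, Set.mem_ofPred_eq]
    constructor
    · rintro ⟨_, ⟨_, ⟨M, hM, hc, rfl⟩, rfl⟩, _, ⟨e, he, rfl⟩, rfl⟩
      refine ⟨(e ::ₘ M).sum, ⟨e ::ₘ M, ?_, by simp [hc], rfl⟩, ?_⟩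
      · intro g hg
        rcases Multiset.mem_cons.mp hg with rfl | hg
        exacts [he, hM g hg]
      · rw [MvPolynomial.monomial_mul, Multiset.sum_cons, add_comm, one_mul]
    · rintro ⟨_, ⟨M, hM, hc, rfl⟩, rfl⟩
      obtain ⟨e, he⟩ := Multiset.card_pos_iff_exists_mem.mp (show 0 < M.card by omega)
      obtain ⟨M, rfl⟩ := Multiset.exists_cons_of_mem he
      refine ⟨_, ⟨M.sum, ⟨M, fun g hg => hM g (Multiset.mem_cons_of_mem hg), by simpa using hc,
        rfl⟩, rfl⟩, _, ⟨e, hM e (Multiset.mem_cons_self _ _), rfl⟩, ?_⟩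
      rw [MvPolynomial.monomial_mul, Multiset.sum_cons, add_comm, one_mul]

theorem mem_span_monomial_pow {E : Set (σ →₀ ℕ)} {k : ℕ} {f : MvPolynomial σ K} :
    f ∈ Ideal.span ((fun a => MvPolynomial.monomial a (1 : K)) '' E) ^ k ↔
      ∀ a ∈ f.support, ∃ M L, IsPacking E a M L ∧ M.card = k := by
  rw [span_monomial_pow, MvPolynomial.mem_ideal_span_monomial_image]
  refine forall₂_congr fun a _ => ⟨?_, ?_⟩
  · rintro ⟨_, ⟨M, hM, hc, rfl⟩, hle⟩
    exact ⟨M, a - M.sum, ⟨hM, add_tsub_cancel_of_le hle⟩, hc⟩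
  · rintro ⟨M, L, hM, hc⟩
    exact ⟨M.sum, ⟨M, hM.mem, hc, rfl⟩, hM.sum_add ▸ le_self_add⟩

theorem strongPersistence_span_monomial {E : Set (σ →₀ ℕ)} (hE : ∀ e ∈ E, e.degree ≤ 2)
    (hne : E.Nonempty) :
    StrongPersistence (Ideal.span ((fun a => MvPolynomial.monomial a (1 : K)) '' E)) := by
  intro k _
  apply le_antisymm
  · intro f hf
    rw [Submodule.mem_colon] at hf
    rw [mem_span_monomial_pow]
    intro a ha
    refine exists_packing_of_forall_add hE hne fun e he => ?_
    have := hf _ (Ideal.subset_span ⟨e, he, rfl⟩)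
    rw [smul_eq_mul, mem_span_monomial_pow] at this
    apply this
    rw [MvPolynomial.mem_support_iff, MvPolynomial.coeff_mul_monomial, mul_one]
    exact MvPolynomial.mem_support_iff.mp ha
  · intro f hf
    rw [Submodule.mem_colon]
    intro g hg
    rw [smul_eq_mul, pow_succ]
    exact Ideal.mul_mem_mul hf hg

end Monomial

theorem IsMonomialIdeal.eq_span_minimalGenerators {n : ℕ} {K : Type*} [Field K]
    {I : Ideal (MvPolynomial (Fin n) K)} (hI : IsMonomialIdeal I) :
    I = Ideal.span ((fun a => MvPolynomial.monomial a (1 : K)) '' minimalGenerators I) := by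
  apply le_antisymm
  · obtain ⟨S, hS⟩ := hI
    conv_lhs => rw [hS]
    rw [Ideal.span_le]
    rintro _ ⟨a, ha, rfl⟩
    have haI : MvPolynomial.monomial a (1 : K) ∈ I := hS ▸ Ideal.subset_span ⟨a, ha, rfl⟩
    obtain ⟨b, hba, hb⟩ := exists_minimal_le_of_wellFoundedLT
      (fun b => MvPolynomial.monomial b (1 : K) ∈ I) a haI
    rw [SetLike.mem_coe, MvPolynomial.mem_ideal_span_monomial_image]
    intro c hc
    obtain rfl := Finset.mem_singleton.mp (MvPolynomial.support_monomial_subset hc)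
    exact ⟨b, hb, hba⟩
  · rw [Ideal.span_le]
    rintro _ ⟨a, ha, rfl⟩
    exact ha.1

/-- If `P = (I ^ k : m)`, then `P = (I ^ (k + 1) : mI)` is the intersection of the ideals `(I ^ (k +
1) : mg)` over finitely many generators `g` of `I`; being prime, `P` equals one of them. -/
theorem StrongPersistence.persistence {R : Type*} [CommRing R] [IsNoetherianRing R] {I : Ideal R}
    (hI : StrongPersistence I) : Persistence I := by
  classical
  intro k hk P hP
  rw [AssociatedPrimes.mem_iff, isAssociatedPrime_iff] at hP ⊢
  obtain ⟨hPp, m, hm⟩ := hP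
  refine ⟨hPp, ?_⟩
  obtain ⟨m, rfl⟩ := Ideal.Quotient.mk_surjective m
  obtain ⟨S, hS⟩ := (isNoetherianRing_iff_ideal_fg R).mp inferInstance I
  have hcol : ∀ (j : ℕ) (y r : R),
      r ∈ Submodule.colon (⊥ : Submodule R (R ⧸ I ^ j)) {Ideal.Quotient.mk (I ^ j) y} ↔
        r * y ∈ I ^ j := by
    intro j y r
    rw [Submodule.mem_colon_singleton, Submodule.mem_bot, ← Ideal.Quotient.eq_zero_iff_mem,
      map_mul]
    rfl
  have hmem : ∀ r, r ∈ P ↔ ∀ g ∈ S, r * (m * g) ∈ I ^ (k + 1) := by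
    intro r
    rw [hm, hcol, ← hI k hk, ← hS, Ideal.colon_span, Submodule.mem_colon]
    simp only [smul_eq_mul, mul_assoc, Finset.mem_coe]
  have hinf : S.inf (fun g => Submodule.colon (⊥ : Submodule R (R ⧸ I ^ (k + 1)))
      {Ideal.Quotient.mk (I ^ (k + 1)) (m * g)}) ≤ P := by
    intro r hr
    rw [hmem]
    intro g hg
    rw [← hcol]
    exact Finset.inf_le (f := fun g => Submodule.colon (⊥ : Submodule R (R ⧸ I ^ (k + 1)))
      {Ideal.Quotient.mk (I ^ (k + 1)) (m * g)}) hg hr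
  obtain ⟨g, hg, hgP⟩ := hPp.inf_le'.mp hinf
  refine ⟨_, le_antisymm (fun r hr => ?_) hgP⟩
  rw [hcol]
  exact (hmem r).mp hr g hg

theorem persistence_bot {R : Type*} [CommRing R] : Persistence (⊥ : Ideal R) := by
  intro k hk
  rw [← Ideal.zero_eq_bot, zero_pow (by omega), zero_pow (by omega)]

theorem mainTheorem1 {n : ℕ} {K : Type*} [Field K] (I : Ideal (MvPolynomial (Fin n) K))
    (hI : IsMonomialIdeal I) (hdeg : monomialIdealDegree I ≤ 2) :
    (I ≠ ⊥ → StrongPersistence I) ∧ Persistence I := by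
  have hspan := hI.eq_span_minimalGenerators
  have hE : ∀ e ∈ minimalGenerators I, e.degree ≤ 2 := fun e he =>
    (Finset.le_sup (f := Finsupp.degree)
      ((minimalGenerators_finite I).mem_toFinset.mpr he)).trans hdeg
  have hstrong : I ≠ ⊥ → StrongPersistence I := by
    intro hne
    rw [hspan]
    refine strongPersistence_span_monomial hE (Set.nonempty_iff_ne_empty.mpr fun h => hne ?_)
    rw [hspan, h, Set.image_empty, Ideal.span_empty]
  refine ⟨hstrong, ?_⟩
  by_cases h : I = ⊥
  · rw [h]
    exact persistence_bot
  · exact (hstrong h).persistence
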